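/- A differential ring is a commutative ring with identity equipped with a finite set $\Delta$ of pairwise commuting derivations; $\Delta$ is the same for all rings considered. A differential ideal is an ideal stable under every $\delta\in\Delta$; differential homomorphisms are ring homomorphisms commuting with every $\delta\in\Delta$. A Ritt algebra is a differential ring that is a $\mathbb{Q}$-algebra. For a differential ring $B$ and $s\in B$, the localization $B_s=B[1/s]$ carries the unique derivations extending those of $B$. A differential homomorphism $f\colon A\to B$ has the going-down property for differential ideals if for every $1\le m<n$, every chain $\mathfrak p_1\supseteq\cdots\supseteq\mathfrak p_n$ of prime differential ideals of $f(A)$ and every chain $\mathfrak q_1\supseteq\cdots\supseteq\mathfrak q_m$ of prime differential ideals of $B$ with $\mathfrak q_i\cap f(A)=\mathfrak p_i$ for $1\le i\le m$, there are prime differential ideals $\mathfrak q_{m+1},\dots,\mathfrak q_n$ of $B$ such that $\mathfrak q_1\supseteq\cdots\supseteq\mathfrak q_n$ and $\mathfrak q_i\cap f(A)=\mathfrak p_i$ for $1\le i\le n$. Theorem. Let $A\subseteq B$ be Ritt algebras, $A$ a differential subring of $B$, and suppose that $B$ is an integral domain which is differentially finitely generated over $A$ (that is, some finite subset of $B$ is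 contained in no proper differential $A$-subalgebra of $B$). Then there is a nonzero element $s\in B$ such that the natural map $A\to B_s$ is injective and has the going-down property for differential ideals. -/

import Mathlib

/-- A differential ring: a commutative ring with pairwise commuting derivations
indexed by `Δ` (the theorem takes `Δ` to be finite). -/
class DiffRing (Δ : Type*) (R : Type*) [CommRing R] where
  /-- the derivation attached to an index -/
  deriv : Δ → Derivation ℤ R R
  deriv_comm : ∀ (i j : Δ) (x : R), deriv i (deriv j x) = deriv j (deriv i x)

namespace DiffRing

/-- A ring homomorphism between differential rings is differential if it commutes with all
derivations. -/
def IsDiffHom (Δ : Type*) {A B : Type*} [CommRing A] [CommRing B] [DiffRing Δ A] [DiffRing Δ B]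
    (f : A →+* B) : Prop :=
  ∀ (i : Δ) (a : A), f (deriv i a) = deriv i (f a)

/-- A differential ideal: an ideal stable under all derivations. -/
def IsDiffIdeal (Δ : Type*) {R : Type*} [CommRing R] [DiffRing Δ R] (I : Ideal R) : Prop :=
  ∀ (i : Δ), ∀ x ∈ I, deriv i x ∈ I

/-- A prime differential ideal. -/
def IsPrimeDiff (Δ : Type*) {R : Type*} [CommRing R] [DiffRing Δ R] (I : Ideal R) : Prop :=
  I.IsPrime ∧ IsDiffIdeal Δ I

/-- `B` is differentially finitely generated over `A`: there is a finite subset of `B` such that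
the only differential `A`-subalgebra of `B` containing it is `B` itself. -/
def DiffFiniteType (Δ : Type*) (A B : Type*) [CommRing A] [CommRing B] [Algebra A B]
    [DiffRing Δ B] : Prop :=
  ∃ t : Finset B, ∀ S : Subalgebra A B,
    (∀ (i : Δ), ∀ x ∈ S, deriv i x ∈ S) → (t : Set B) ⊆ S → S = ⊤

section Range

variable {Δ : Type*} {A B : Type*} [CommRing A] [CommRing B] [DiffRing Δ A] [DiffRing Δ B]

theorem deriv_mem_range {f : A →+* B} (hf : IsDiffHom Δ f) (i : Δ) (x : f.range) :
    deriv i (x : B) ∈ f.range := by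
  obtain ⟨_, a, rfl⟩ := x
  exact ⟨deriv i a, hf i a⟩

/-- The image `f(A)` of a differential homomorphism `f : A → B`, as a differential subring
of `B`. -/
@[reducible]
def range {f : A →+* B} (hf : IsDiffHom Δ f) : DiffRing Δ f.range where
  deriv i := Derivation.mk'
    { toFun := fun x => ⟨deriv i (x : B), deriv_mem_range hf i x⟩
      map_add' := fun x y => Subtype.ext (by simp)
      map_smul' := fun n x => Subtype.ext (by simp) }
    (fun x y => Subtype.ext (by simp))
  deriv_comm i j x := Subtype.ext (deriv_comm i j (x : B))

/-- Going-down for differential ideals, for a differential homomorphism `f : A → B`: for every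
chain `p₁ ⊇ ⋯ ⊇ pₙ` of prime differential ideals in `f(A)` and every nonempty chain
`q₁ ⊇ ⋯ ⊇ qₘ` (`m < n`) of prime differential ideals in `B` with `qᵢ ∩ f(A) = pᵢ` for `i ≤ m`,
the second chain extends to a chain `q₁ ⊇ ⋯ ⊇ qₙ` of prime differential ideals in `B` with
`qᵢ ∩ f(A) = pᵢ` for all `i ≤ n`. -/
def HasDiffGoingDown (f : A →+* B) (hf : IsDiffHom Δ f) : Prop :=
  letI : DiffRing Δ f.range := range hf
  ∀ (n m : ℕ) (_ : 0 < m) (hmn : m < n)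
    (p : Fin n → Ideal f.range) (q : Fin m → Ideal B),
    Antitone p → (∀ k, IsPrimeDiff Δ (p k)) →
    Antitone q → (∀ k, IsPrimeDiff Δ (q k)) →
    (∀ k, (q k).comap f.range.subtype = p (Fin.castLE hmn.le k)) →
    ∃ q' : Fin n → Ideal B,
      Antitone q' ∧ (∀ k, IsPrimeDiff Δ (q' k)) ∧
      (∀ k, q' (Fin.castLE hmn.le k) = q k) ∧
      ∀ k, (q' k).comap f.range.subtype = p k

end Range

section Localization

variable {B : Type*} [CommRing B] (s : B) (L : Type*) [CommRing L] [Algebra B L]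

/-- The ring homomorphism `b ↦ b + D(b) ε` from `B` to the dual numbers over a `B`-algebra `L`. -/
def toDual (D : Derivation ℤ B B) : B →+* TrivSqZeroExt L L where
  toFun b := TrivSqZeroExt.inl (algebraMap B L b) + TrivSqZeroExt.inr (algebraMap B L (D b))
  map_one' := by ext <;> simp
  map_zero' := by ext <;> simp
  map_add' x y := by ext <;> simp [-DualNumber.inr_eq_smul_eps]
  map_mul' x y := by ext <;> simp [-DualNumber.inr_eq_smul_eps, mul_comm]

theorem fst_toDual (D : Derivation ℤ B B) (b : B) : (toDual L D b).fst = algebraMap B L b := by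
  simp [toDual]

theorem snd_toDual (D : Derivation ℤ B B) (b : B) :
    (toDual L D b).snd = algebraMap B L (D b) := by
  simp [toDual, -DualNumber.inr_eq_smul_eps]

variable [IsLocalization.Away s L]

theorem isUnit_toDual (D : Derivation ℤ B B) (y : Submonoid.powers s) :
    IsUnit (toDual L D y) := by
  rw [TrivSqZeroExt.isUnit_iff_isUnit_fst, fst_toDual]
  exact IsLocalization.map_units L y

/-- The extension of `toDual` to the localization `L = B_s`. -/
noncomputable def awayToDual (D : Derivation ℤ B B) : L →+* TrivSqZeroExt L L :=
  IsLocalization.lift (M := Submonoid.powers s) (isUnit_toDual s L D)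

theorem awayToDual_algebraMap (D : Derivation ℤ B B) (b : B) :
    awayToDual s L D (algebraMap B L b) = toDual L D b :=
  IsLocalization.lift_eq _ b

theorem fst_awayToDual (D : Derivation ℤ B B) (x : L) : (awayToDual s L D x).fst = x := by
  have h : ((TrivSqZeroExt.fstHom L L L).toRingHom.comp (awayToDual s L D)) = RingHom.id L := by
    apply IsLocalization.ringHom_ext (Submonoid.powers s)
    ext b
    have := fst_toDual L D b
    rw [← awayToDual_algebraMap s L D b] at this
    exact this
  exact congrArg (fun g => g x) h

/-- The unique extension of a derivation of `B` to the localization `L = B_s`. -/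
noncomputable def awayDeriv (D : Derivation ℤ B B) : Derivation ℤ L L :=
  Derivation.mk'
    ((AddMonoidHom.mk' (fun x => (awayToDual s L D x).snd) (fun x y => by simp)).toIntLinearMap)
    (fun x y => by simp [fst_awayToDual, mul_comm])

theorem awayDeriv_algebraMap (D : Derivation ℤ B B) (b : B) :
    awayDeriv s L D (algebraMap B L b) = algebraMap B L (D b) := by
  change (awayToDual s L D (algebraMap B L b)).snd = _
  rw [awayToDual_algebraMap, snd_toDual]

/-- A derivation of `L = B_s` vanishing on the image of `B` is zero. -/
theorem away_deriv_eq_zero {B : Type*} [CommRing B] (s : B) (L : Type*) [CommRing L]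
    [Algebra B L] [IsLocalization.Away s L] (D : Derivation ℤ L L)
    (h : ∀ b : B, D (algebraMap B L b) = 0) (x : L) : D x = 0 := by
  obtain ⟨⟨b, y⟩, hb⟩ := IsLocalization.surj (Submonoid.powers s) x
  have h1 := congrArg D hb
  simp only [Derivation.leibniz, h, zero_add, smul_eq_mul, mul_zero] at h1
  exact ((IsLocalization.map_units L y).mul_right_eq_zero).1 h1

theorem awayDeriv_comm (D E : Derivation ℤ B B) (hDE : ∀ b, D (E b) = E (D b)) (x : L) :
    awayDeriv s L D (awayDeriv s L E x) = awayDeriv s L E (awayDeriv s L D x) := by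
  have h := away_deriv_eq_zero s L ⁅awayDeriv s L D, awayDeriv s L E⁆
    (fun b => by simp only [Derivation.commutator_apply, awayDeriv_algebraMap, hDE, sub_self]) x
  rw [Derivation.commutator_apply] at h
  exact sub_eq_zero.1 h

variable {Δ : Type*} [DiffRing Δ B]

/-- The localization `B_s = B[1/s]` of a differential ring, with the extended derivations. -/
noncomputable instance away : DiffRing Δ (Localization.Away s) where
  deriv i := awayDeriv s (Localization.Away s) (deriv i)
  deriv_comm i j x := awayDeriv_comm s _ (deriv i) (deriv j) (deriv_comm i j) x

/-- If `A → B` is differential then so is `A → B_s`. -/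
theorem isDiffHom_away {A : Type*} [CommRing A] [DiffRing Δ A] [Algebra A B]
    (h : IsDiffHom Δ (algebraMap A B)) :
    IsDiffHom Δ (algebraMap A (Localization.Away s)) := by
  intro i a
  rw [IsScalarTower.algebraMap_apply A B (Localization.Away s),
    IsScalarTower.algebraMap_apply A B (Localization.Away s), h i a]
  exact (awayDeriv_algebraMap s (Localization.Away s) (deriv i) _).symm

end Localization

end DiffRing

/-! Flatness implies going-down, so it suffices to find `s ≠ 0` with `B_s` flat over `A`. Ordinary
going-down along a flat map yields a prime `P ⊆ q'` over a differential prime `p`. Shrink `P` to a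
minimal prime of the extended ideal `pB`: it still contracts to `p`, and it is differential because
over `ℚ` minimal primes of differential ideals are differential.

Generic flatness (`DiffRing.genericallyFlat`) comes from ranking the derivatives of the generators
by a well-order compatible with derivation. Those transcendental over their predecessors are
algebraically independent over `A` and generate a polynomial ring `P`, flat over `A`. Among the
algebraic ones, Dickson's lemma leaves finitely many that are not proper derivatives of others in a
finite set. Differentiating a minimal relation for each of these shows that its separant times any
proper derivative is a polynomial in lower terms. Inverting the finitely many separants thus makes
`B` finitely generated over `P`, and generic flatness for finite type extensions of domains finishes
the proof. -/

open Polynomial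

namespace DiffRing

/-! ### Minimal primes over differential ideals -/

section MinimalPrimes

variable {Δ R : Type*} [CommRing R] [DiffRing Δ R]

theorem isDiffIdeal_of_mem_minimalPrimes [Algebra ℚ R] {I p : Ideal R}
    (hI : IsDiffIdeal Δ I) (hp : p ∈ I.minimalPrimes) : IsDiffIdeal Δ p := by
  intro i x hx
  have hpp : p.IsPrime := hp.1.1
  by_contra hdx
  -- Descent on the exponent: differentiating `x ^ (n + 1) * y`, multiplying by `y` and dividing by
  -- `n + 1` gives `x ^ n * (δx * y²) ∈ I`, where `δx * y²` is again outside `p`.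
  have key : ∀ n : ℕ, ∀ y ∉ p, x ^ n * y ∉ I := by
    intro n
    induction n with
    | zero => exact fun y hy h => hy (hp.1.2 (by simpa using h))
    | succ n ih =>
      intro y hy h
      refine ih (deriv i x * (y * y)) (fun h' => ?_) ?_
      · rcases hpp.mem_or_mem h' with h' | h'
        · exact hdx h'
        · exact (hpp.mem_or_mem h').elim hy hy
      · have h1 : ((n + 1 : ℕ) : R) * (x ^ n * (deriv i x * (y * y))) ∈ I := by
          have h2 := I.sub_mem (I.mul_mem_left y (hI i _ h)) (I.mul_mem_left (deriv i y) h)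
          have h3 : y * deriv i (x ^ (n + 1) * y) - deriv i y * (x ^ (n + 1) * y) =
              ((n + 1 : ℕ) : R) * (x ^ n * (deriv i x * (y * y))) := by
            rw [Derivation.leibniz, Derivation.leibniz_pow]
            simp only [smul_eq_mul, nsmul_eq_mul, Nat.add_sub_cancel]
            ring
          rwa [h3] at h2
        have h4 := I.mul_mem_left (algebraMap ℚ R ((n + 1 : ℕ) : ℚ)⁻¹) h1
        rwa [← mul_assoc, ← map_natCast (algebraMap ℚ R), ← map_mul, inv_mul_cancel₀
          (Nat.cast_ne_zero.2 n.succ_ne_zero), map_one, one_mul] at h4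
  -- By minimality, `x` is nilpotent modulo `I` after localizing at `p`; otherwise a prime over `I`
  -- inside `p` would avoid `x`.
  obtain ⟨n, y, hy, h⟩ : ∃ n : ℕ, ∃ y ∉ p, x ^ n * y ∈ I := by
    by_contra! h
    have hdisj : Disjoint (I : Set R) (Submonoid.powers x ⊔ p.primeCompl : Submonoid R) := by
      rw [Set.disjoint_left]
      intro z hz hz'
      obtain ⟨_, ⟨n, rfl⟩, y, hy, rfl⟩ := Submonoid.mem_sup.1 hz'
      exact h n y hy hz
    obtain ⟨P, hP, hIP, hPd⟩ := Ideal.exists_le_prime_disjoint I _ hdisj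
    have hPp : P ≤ p := fun z hz => by
      by_contra hzp
      exact Set.disjoint_left.1 hPd hz (Submonoid.mem_sup_right (S := Submonoid.powers x) hzp)
    exact Set.disjoint_left.1 hPd (hp.2 ⟨hP, hIP⟩ hPp hx)
      (Submonoid.mem_sup_left (Submonoid.mem_powers x))
  exact key n y hy h

theorem isDiffIdeal_map {A : Type*} [CommRing A] [DiffRing Δ A] {f : A →+* R}
    (hf : IsDiffHom Δ f) {I : Ideal A} (hI : IsDiffIdeal Δ I) : IsDiffIdeal Δ (I.map f) := by
  intro i x hx
  induction hx using Submodule.span_induction with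
  | mem x h =>
    obtain ⟨a, ha, rfl⟩ := h
    rw [← hf]
    exact Ideal.mem_map_of_mem f (hI i a ha)
  | zero => simp
  | add x y _ _ hx hy => rw [map_add]; exact add_mem hx hy
  | smul a x h hx =>
    rw [smul_eq_mul, Derivation.leibniz]
    exact add_mem (Ideal.mul_mem_left _ _ hx) (Ideal.mul_mem_right _ _ h)

end MinimalPrimes

/-! ### Going-down along flat maps -/

section GoingDown

variable {Δ A B : Type*} [CommRing A] [CommRing B] [DiffRing Δ A] [DiffRing Δ B]

/-- One step of going-down for differential ideals along a flat extension of Ritt algebras. -/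
theorem exists_isPrimeDiff_le_of_flat [Algebra ℚ B] [Algebra A B] [Module.Flat A B]
    (hf : IsDiffHom Δ (algebraMap A B)) {p p' : Ideal A} (hp : IsPrimeDiff Δ p) (hpp : p ≤ p')
    {q' : Ideal B} (hq' : IsPrimeDiff Δ q') (h : q'.comap (algebraMap A B) = p') :
    ∃ q : Ideal B, IsPrimeDiff Δ q ∧ q ≤ q' ∧ q.comap (algebraMap A B) = p := by
  have := hp.1
  have := hq'.1
  have : p'.IsPrime := h ▸ inferInstance
  have : q'.LiesOver p' := ⟨h.symm⟩
  obtain ⟨P, hP, hPp, hPl⟩ := Ideal.exists_ideal_le_liesOver_of_le (S := B) (p := p) (q := p') q' hpp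
  have hle : p.map (algebraMap A B) ≤ P := Ideal.map_le_iff_le_comap.2 hPl.over.le
  obtain ⟨q, hq, hqP⟩ := Ideal.exists_minimalPrimes_le hle
  refine ⟨q, ⟨hq.1.1, isDiffIdeal_of_mem_minimalPrimes (isDiffIdeal_map hf hp.2) hq⟩,
    hqP.trans hP, le_antisymm ?_ ?_⟩
  · exact (Ideal.comap_mono hqP).trans hPl.over.ge
  · exact Ideal.map_le_iff_le_comap.1 hq.1.2

theorem comap_rangeRestrict_isPrimeDiff {f : A →+* B} (hf : IsDiffHom Δ f) {p : Ideal f.range}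
    (hp : letI := range hf; IsPrimeDiff Δ p) : IsPrimeDiff Δ (p.comap f.rangeRestrict) := by
  let _ := range hf
  have := hp.1
  refine ⟨inferInstance, fun i x hx => ?_⟩
  have h1 := hp.2 i _ hx
  have h2 : f.rangeRestrict (deriv i x) = deriv i (f.rangeRestrict x) := Subtype.ext (hf i x)
  rw [Ideal.mem_comap, h2]
  exact h1

theorem hasDiffGoingDown_of_flat [Algebra ℚ B] [Algebra A B] [Module.Flat A B]
    (hf : IsDiffHom Δ (algebraMap A B)) : HasDiffGoingDown (algebraMap A B) hf := by
  intro n m hm hmn p q hp hpd hq hqd hpq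
  let _ : DiffRing Δ (algebraMap A B).range := range hf
  have step : ∀ {p p' : Ideal (algebraMap A B).range}, IsPrimeDiff Δ p → p ≤ p' →
      ∀ {q' : Ideal B}, IsPrimeDiff Δ q' → q'.comap (algebraMap A B).range.subtype = p' →
      ∃ q : Ideal B, IsPrimeDiff Δ q ∧ q ≤ q' ∧ q.comap (algebraMap A B).range.subtype = p := by
    intro p p' hp hle q' hq' h
    have hcomap (q : Ideal B) : (q.comap (algebraMap A B).range.subtype).comap
        (algebraMap A B).rangeRestrict = q.comap (algebraMap A B) := Ideal.comap_comap _ _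
    obtain ⟨q, hq, hqq, hqp⟩ := exists_isPrimeDiff_le_of_flat hf
      (comap_rangeRestrict_isPrimeDiff hf hp)
      (Ideal.comap_mono (f := (algebraMap A B).rangeRestrict) hle) hq' (by rw [← hcomap, h])
    refine ⟨q, hq, hqq, Ideal.comap_injective_of_surjective _
      (algebraMap A B).rangeRestrict_surjective ?_⟩
    rw [hcomap, hqp]
  induction n with
  | zero => omega
  | succ n ih =>
    obtain ⟨q₀, hq₀, hq₀d, hq₀e, hq₀p⟩ : ∃ q' : Fin n → Ideal B,
          Antitone q' ∧ (∀ k, IsPrimeDiff Δ (q' k)) ∧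
          (∀ (k : Fin m) (hk : k.1 < n), q' ⟨k, hk⟩ = q k) ∧
          ∀ k, (q' k).comap (algebraMap A B).range.subtype = p k.castSucc := by
      rcases Nat.lt_or_ge m n with hlt | hge
      · obtain ⟨q', h1, h2, h3, h4⟩ := ih hlt (fun k => p k.castSucc)
          (fun a b hab => hp (Fin.castSucc_le_castSucc_iff.2 hab)) (fun k => hpd _) hpq
        exact ⟨q', h1, h2, fun k _ => h3 k, h4⟩
      · obtain rfl : m = n := by omega
        exact ⟨q, hq, hqd, fun k _ => rfl, hpq⟩
    -- Since `0 < m ≤ n`, the chain built so far has a last member to descend from.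
    obtain ⟨n, rfl⟩ : ∃ n', n = n' + 1 := ⟨n - 1, by omega⟩
    obtain ⟨r, hr, hrq, hrp⟩ := step (hpd (Fin.last (n + 1)))
      (hp (Fin.le_last (Fin.last n).castSucc)) (hq₀d (Fin.last n)) (hq₀p _)
    refine ⟨Fin.snoc q₀ r, ?_, fun k => ?_, fun k => ?_, fun k => ?_⟩
    · intro a b hab
      induction b using Fin.lastCases with
      | last =>
        induction a using Fin.lastCases with
        | last => exact le_rfl
        | cast a =>
          rw [Fin.snoc_last, Fin.snoc_castSucc]
          exact hrq.trans (hq₀ (Fin.le_last a))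
      | cast b =>
        induction a using Fin.lastCases with
        | last => exact absurd hab (not_le.2 (Fin.castSucc_lt_last b))
        | cast a =>
          rw [Fin.snoc_castSucc, Fin.snoc_castSucc]
          exact hq₀ (Fin.castSucc_le_castSucc_iff.1 hab)
    · induction k using Fin.lastCases with
      | last => rwa [Fin.snoc_last]
      | cast k => rw [Fin.snoc_castSucc]; exact hq₀d k
    · have hk : k.1 < n + 1 := by omega
      have : Fin.castLE hmn.le k = Fin.castSucc ⟨k, hk⟩ := rfl
      rw [this, Fin.snoc_castSucc, hq₀e]
    · induction k using Fin.lastCases with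
      | last => rwa [Fin.snoc_last]
      | cast k => rw [Fin.snoc_castSucc]; exact hq₀p k

end GoingDown

end DiffRing

/-- `B` becomes flat over `R` after inverting some nonzero element of `B`. -/
def GenericallyFlat (R B : Type*) [CommRing R] [CommRing B] [Algebra R B] : Prop :=
  ∃ t : B, t ≠ 0 ∧ Module.Flat R (Localization.Away t)

/-! ### Generic flatness for finite type extensions of domains -/

namespace GenericallyFlat

theorem of_flat (R B : Type*) [CommRing R] [CommRing B] [Nontrivial B] [Algebra R B]
    [Module.Flat R B] : GenericallyFlat R B :=
  ⟨1, one_ne_zero, inferInstance⟩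

/-- Inverting both elements in `B` gives a ring flat over `C` in which `s` is a unit, hence flat
over `C_s`, which is flat over `R`. -/
theorem trans {R C B : Type*} [CommRing R] [CommRing C] [CommRing B] [IsDomain B] [Algebra R C]
    [Algebra C B] [Algebra R B] [IsScalarTower R C B]
    (hinj : Function.Injective (algebraMap C B)) (h₁ : GenericallyFlat R C)
    (h₂ : GenericallyFlat C B) : GenericallyFlat R B := by
  obtain ⟨s, hs, hsf⟩ := h₁
  obtain ⟨t, ht, htf⟩ := h₂
  refine ⟨algebraMap C B s * t, mul_ne_zero ((map_ne_zero_iff _ hinj).2 hs) ht, ?_⟩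
  let T := Localization.Away t
  let L := Localization.Away (algebraMap B T (algebraMap C B s))
  have : Module.Flat C L := inferInstance
  have hu : IsUnit (algebraMap C L s) := by
    rw [IsScalarTower.algebraMap_apply C B L, IsScalarTower.algebraMap_apply B T L]
    exact IsLocalization.Away.algebraMap_isUnit _
  let φ : Localization.Away s →ₐ[C] L :=
    IsLocalization.Away.liftAlgHom (S := Localization.Away s) s (f := Algebra.ofId C L) hu
  let _ : Algebra (Localization.Away s) L := φ.toRingHom.toAlgebra
  have : IsScalarTower C (Localization.Away s) L := IsScalarTower.of_algebraMap_eq'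
    φ.comp_algebraMap.symm
  have : IsScalarTower R (Localization.Away s) L := by
    refine IsScalarTower.of_algebraMap_eq' ?_
    rw [IsScalarTower.algebraMap_eq R C L, IsScalarTower.algebraMap_eq C (Localization.Away s) L,
      RingHom.comp_assoc, ← IsScalarTower.algebraMap_eq R C (Localization.Away s)]
  have : Module.Flat (Localization.Away s) L :=
    (Module.flat_iff_of_isLocalization _ (Submonoid.powers s) L).2 inferInstance
  have : Module.Flat R L := Module.Flat.trans R (Localization.Away s) L
  exact Module.Flat.of_linearEquiv
    (((IsLocalization.algEquiv (Submonoid.powers (algebraMap C B s * t))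
      (Localization.Away (algebraMap C B s * t)) L).restrictScalars R).toLinearEquiv)

theorem of_away {R B : Type*} [CommRing R] [CommRing B] [IsDomain B] [Algebra R B] {s : B}
    (hs : s ≠ 0) (h : GenericallyFlat R (Localization.Away s)) : GenericallyFlat R B := by
  obtain ⟨t, ht, htf⟩ := h
  obtain ⟨n, a, ha⟩ := IsLocalization.Away.surj s t
  have hu : IsUnit (algebraMap B (Localization.Away s) s) := IsLocalization.Away.algebraMap_isUnit _
  have hassoc : Associated t (algebraMap B (Localization.Away s) a) :=
    ⟨hu.unit ^ n, by simpa using ha⟩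
  have := IsLocalization.Away.of_associated (S := Localization.Away t) hassoc
  have h1 : IsLocalization.Away (a * s) (Localization.Away t) :=
    IsLocalization.Away.mul (Localization.Away s) _ s a
  refine ⟨a * s, mul_ne_zero ?_ hs, ?_⟩
  · rintro rfl
    rw [map_zero] at hassoc
    exact ht ((associated_zero_iff_eq_zero t).1 hassoc)
  · exact Module.Flat.of_linearEquiv
      (((IsLocalization.algEquiv (Submonoid.powers (a * s))
        (Localization.Away (a * s)) (Localization.Away t)).restrictScalars R).toLinearEquiv)

theorem of_transcendental {C B : Type*} [CommRing C] [CommRing B] [IsDomain B] [Algebra C B]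
    {b : B} (hb : Transcendental C b) (htop : Algebra.adjoin C {b} = ⊤) : GenericallyFlat C B := by
  have hs : Function.Surjective (aeval (R := C) b) := by
    rw [← AlgHom.range_eq_top, ← htop, Algebra.adjoin_singleton_eq_range_aeval]
  have := Module.Flat.of_linearEquiv (AlgEquiv.ofBijective (aeval (R := C) b)
    ⟨transcendental_iff_injective.1 hb, hs⟩).symm.toLinearEquiv
  exact of_flat C B

/-- Once the leading coefficient `c` of a relation of minimal degree `d` is inverted, `1, b, …, b ^
(d - 1)` is a basis: minimality gives independence, pseudo-division gives generation. -/
theorem of_isAlgebraic {C B : Type*} [CommRing C] [CommRing B] [IsDomain B] [Algebra C B]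
    (hinj : Function.Injective (algebraMap C B))
    {b : B} (hb : IsAlgebraic C b) (htop : Algebra.adjoin C {b} = ⊤) : GenericallyFlat C B := by
  classical
  have hH : ∃ d : ℕ, ∃ F : C[X], F ≠ 0 ∧ aeval b F = 0 ∧ F.natDegree = d := by
    obtain ⟨F, hF, h⟩ := hb
    exact ⟨_, F, hF, h, rfl⟩
  obtain ⟨F, hF, hFb, hFd⟩ := Nat.find_spec hH
  have hmin : ∀ G : C[X], aeval b G = 0 → G.natDegree < F.natDegree → G = 0 := by
    intro G hG hd
    by_contra hG0
    exact Nat.find_min hH (hFd ▸ hd) ⟨G, hG0, hG, rfl⟩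
  set d := F.natDegree with hd
  set c := F.leadingCoeff with hc
  have hc0 : c ≠ 0 := leadingCoeff_ne_zero.2 hF
  have hcB : algebraMap C B c ≠ 0 := (map_ne_zero_iff _ hinj).2 hc0
  let φ : degreeLT C d →ₗ[C] B := (aeval (R := C) b).toLinearMap ∘ₗ (degreeLT C d).subtype
  have hφ : Function.Injective φ := by
    rw [injective_iff_map_eq_zero]
    rintro ⟨G, hG⟩ h
    have h' : aeval b G = 0 := h
    by_cases hG0 : G = 0
    · simp [hG0]
    · exact Subtype.ext (hmin G h' ((natDegree_lt_iff_degree_lt hG0).2 (mem_degreeLT.1 hG)))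
  have hd0 : 0 < d := by
    refine Nat.pos_of_ne_zero fun h0 => hcB ?_
    rw [eq_C_of_natDegree_eq_zero h0, aeval_C] at hFb
    rwa [hc, leadingCoeff, ← hd, h0]
  -- Pseudo-division by `F`: each cancellation of leading terms costs one factor `c`.
  have hred : ∀ n : ℕ, ∀ G : C[X], G.natDegree < d + n →
      ∃ k : ℕ, ∃ H ∈ degreeLT C d, c ^ k • aeval b G = aeval b H := by
    intro n
    induction n with
    | zero =>
      intro G hG
      refine ⟨0, G, mem_degreeLT.2 ?_, by simp⟩
      exact degree_lt_iff_coeff_zero _ _ |>.2 fun m hm =>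
        coeff_eq_zero_of_natDegree_lt (lt_of_lt_of_le hG hm)
    | succ n ih =>
      intro G hG
      rcases Nat.lt_or_ge G.natDegree (d + n) with hlt | hge
      · exact ih G hlt
      · have hdG : d ≤ G.natDegree := by omega
        have h1 : (F.cancelLeads G).natDegree < d + n :=
          (natDegree_cancelLeads_lt_of_natDegree_le_natDegree hdG (by omega)).trans_le (by omega)
        obtain ⟨k, H, hH, h2⟩ := ih _ h1
        refine ⟨k + 1, H, hH, ?_⟩
        rw [← h2, pow_succ, mul_smul]
        congr 1
        rw [cancelLeads, map_sub, map_mul _ _ F, hFb, mul_zero, sub_zero, ← hd,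
          Nat.sub_eq_zero_of_le hdG, pow_zero, mul_one, map_mul, aeval_C, Algebra.smul_def]
  have hflat : Module.Flat C (degreeLT C d) := Module.Flat.of_linearEquiv (degreeLTEquiv C d)
  let s := algebraMap C B c
  let L := Localization.Away s
  have hBL : Function.Injective (algebraMap B L) :=
    IsLocalization.injective L (powers_le_nonZeroDivisors_of_noZeroDivisors hcB)
  let ψ : degreeLT C d →ₗ[C] L := (IsScalarTower.toAlgHom C B L).toLinearMap ∘ₗ φ
  have hcL : IsUnit (algebraMap C L c) := by
    rw [IsScalarTower.algebraMap_apply C B L]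
    exact IsLocalization.Away.algebraMap_isUnit s
  -- So `B_c` is the localization at `c` of the free module of polynomials of degree below `d`.
  have hloc : IsLocalizedModule (Submonoid.powers c) ψ := by
    refine ⟨?_, fun y => ?_, fun {x₁ x₂} h => ⟨1, ?_⟩⟩
    · rintro ⟨_, n, rfl⟩
      rw [Module.End.isUnit_iff]
      have hu := hcL.pow n
      rw [← map_pow] at hu
      have : ⇑(algebraMap C (Module.End C L) (c ^ n)) = fun x : L => algebraMap C L (c ^ n) * x := by
        ext x
        rw [Module.algebraMap_end_apply, Algebra.smul_def]
      rw [this]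
      exact hu.unit.mulLeft_bijective
    · obtain ⟨n, a, ha⟩ := IsLocalization.Away.surj s y
      have ha' : a ∈ (aeval (R := C) b).range := by
        rw [← Algebra.adjoin_singleton_eq_range_aeval, htop]
        trivial
      obtain ⟨G, rfl⟩ := ha'
      obtain ⟨k, H, hH, h2⟩ := hred (G.natDegree + 1) G (by omega)
      refine ⟨⟨⟨H, hH⟩, ⟨c ^ (k + n), k + n, rfl⟩⟩, ?_⟩
      change c ^ (k + n) • y = algebraMap B L (aeval b H)
      rw [← h2, Algebra.smul_def, Algebra.smul_def, map_mul, ← IsScalarTower.algebraMap_apply C B L]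
      erw [← ha]
      rw [← IsScalarTower.algebraMap_apply C B L, map_pow, map_pow]
      ring
    · rw [hφ (hBL h)]
  have : Module.Flat C (LocalizedModule (Submonoid.powers c) (degreeLT C d)) :=
    Module.Flat.trans C (Localization (Submonoid.powers c)) _
  exact ⟨s, hcB, Module.Flat.of_linearEquiv (IsLocalizedModule.iso (Submonoid.powers c) ψ).symm⟩

theorem of_adjoin_singleton {C B : Type*} [CommRing C] [CommRing B] [IsDomain B] [Algebra C B]
    (hinj : Function.Injective (algebraMap C B)) {b : B} (htop : Algebra.adjoin C {b} = ⊤) :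
    GenericallyFlat C B := by
  by_cases hb : IsAlgebraic C b
  · exact of_isAlgebraic hinj hb htop
  · exact of_transcendental hb htop

theorem restrictScalars {R B : Type*} [CommRing R] [CommRing B] [Algebra R B]
    {C : Subalgebra R B} {D : Subalgebra C B} (h : GenericallyFlat R D) :
    GenericallyFlat R (D.restrictScalars R) := h

theorem adjoin_singleton {R B : Type*} [CommRing R] [CommRing B] [IsDomain B] [Algebra R B]
    {C : Subalgebra R B} (h : GenericallyFlat R C) {b : B} {D : Subalgebra C B}
    (hD : Algebra.adjoin C ({b} : Set B) = D) : GenericallyFlat R D := by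
  have hmem : b ∈ D := hD ▸ Algebra.subset_adjoin rfl
  have hmap : (Algebra.adjoin C ({⟨b, hmem⟩} : Set D)).map D.val = D := by
    rw [AlgHom.map_adjoin, Set.image_singleton]
    exact hD
  have htop : Algebra.adjoin C ({⟨b, hmem⟩} : Set D) = ⊤ := by
    refine top_unique fun x _ => ?_
    have hx : (x : B) ∈ (Algebra.adjoin C ({⟨b, hmem⟩} : Set D)).map D.val := hmap.symm ▸ x.2
    obtain ⟨y, hy, hyx⟩ := hx
    rwa [Subtype.ext hyx] at hy
  have hCD : Function.Injective (algebraMap C D) := fun x y h =>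
    Subtype.ext (congrArg (fun z : D => (z : B)) h)
  exact h.trans hCD (of_adjoin_singleton hCD htop)

theorem adjoin_finset {R B : Type*} [CommRing R] [CommRing B] [IsDomain B] [Algebra R B]
    (hinj : Function.Injective (algebraMap R B)) (t : Finset B) :
    GenericallyFlat R (Algebra.adjoin R (t : Set B)) := by
  classical
  induction t using Finset.induction_on with
  | empty =>
    have : Module.Flat R (⊥ : Subalgebra R B) :=
      Module.Flat.of_linearEquiv (Algebra.botEquivOfInjective hinj).toLinearEquiv
    rw [Finset.coe_empty, Algebra.adjoin_empty]
    exact of_flat _ _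
  | insert b t _ ih =>
    have h := (ih.adjoin_singleton (b := b) rfl).restrictScalars
    rwa [← Algebra.adjoin_union_eq_adjoin_adjoin, Set.union_comm, ← Set.insert_eq,
      ← Finset.coe_insert] at h

theorem of_finiteType {R B : Type*} [CommRing R] [CommRing B] [IsDomain B] [Algebra R B]
    (hinj : Function.Injective (algebraMap R B)) [h : Algebra.FiniteType R B] :
    GenericallyFlat R B := by
  obtain ⟨t, ht⟩ := h.out
  have h1 := adjoin_finset hinj t
  rw [ht] at h1
  have : Module.Flat (⊤ : Subalgebra R B) B :=
    Module.Flat.of_linearEquiv (LinearEquiv.ofBijective (Algebra.linearMap (⊤ : Subalgebra R B) B)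
      ⟨Subtype.val_injective, fun x => ⟨⟨x, trivial⟩, rfl⟩⟩).symm
  exact h1.trans Subtype.val_injective (of_flat _ _)

end GenericallyFlat

/-! ### Generators in triangular form -/

section Triangular

variable {A B I : Type*} [CommRing A] [CommRing B] [Algebra A B]

theorem IsAlgebraic.of_subalgebra_le {C D : Subalgebra A B} (hCD : C ≤ D) {x : B}
    (hx : IsAlgebraic C x) : IsAlgebraic D x := by
  let _ : Algebra C D := (Subalgebra.inclusion hCD).toAlgebra
  have : IsScalarTower C D B := IsScalarTower.of_algebraMap_eq fun _ => rfl
  exact hx.extendScalars (Subalgebra.inclusion_injective hCD)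

/-- Independence involves finitely many members at a time, which can be added in increasing order.
-/
theorem algebraicIndepOn_of_forall_transcendental_Iio [LinearOrder I] [IsDomain B] {u : I → B}
    (hinj : Function.Injective (algebraMap A B)) {N : Set I}
    (hN : ∀ v ∈ N, Transcendental (Algebra.adjoin A (u '' Set.Iio v)) (u v)) :
    AlgebraicIndepOn A u N := by
  classical
  have key : ∀ t : Finset I, (t : Set I) ⊆ N → AlgebraicIndepOn A u (t : Set I) := by
    intro t
    induction t using Finset.induction_on_max with
    | empty =>
      intro _
      rw [Finset.coe_empty]
      exact algebraicIndependent_empty_type_iff.2 hinj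
    | insert a s hs ih =>
      intro hsub
      rw [Finset.coe_insert] at hsub ⊢
      have hsub' := Set.insert_subset_iff.1 hsub
      refine (ih hsub'.2).insert fun halg => hN a hsub'.1 (halg.of_subalgebra_le ?_)
      exact Algebra.adjoin_mono (Set.image_mono fun x hx => hs x hx)
  refine algebraicIndependent_of_finite_type fun t ht => ?_
  have hfin : (Subtype.val '' t : Set I).Finite := ht.image _
  have h := key hfin.toFinset (by
    rw [hfin.coe_toFinset]
    rintro _ ⟨x, _, rfl⟩
    exact x.2)
  rw [hfin.coe_toFinset] at h
  exact h.comp (fun x : t => ⟨x.1.1, x.1, x.2, rfl⟩) fun x y hxy => by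
    simpa [Subtype.ext_iff] using hxy

theorem AlgebraicIndepOn.flat_adjoin {u : I → B} {N : Set I} (h : AlgebraicIndepOn A u N) :
    Module.Flat A (Algebra.adjoin A (u '' N)) := by
  have e := h.aevalEquiv
  exact Module.Flat.of_linearEquiv e.symm.toLinearEquiv

theorem GenericallyFlat.of_quasilinear [Preorder I] [WellFoundedLT I] [IsDomain B] {u : I → B}
    (hinj : Function.Injective (algebraMap A B)) (hu : Algebra.adjoin A (Set.range u) = ⊤)
    (V : Finset I) (T : Finset B) (hT : ∀ S ∈ T, S ≠ 0)
    (h : ∀ v ∉ V, ∃ S ∈ T, S * u v ∈ Algebra.adjoin A (u '' Set.Iio v)) :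
    GenericallyFlat A B := by
  classical
  let s := ∏ S ∈ T, S
  have hs : s ≠ 0 := Finset.prod_ne_zero_iff.2 hT
  let L := Localization.Away s
  let ι : B →ₐ[A] L := IsScalarTower.toAlgHom A B L
  have hι : Function.Injective ι :=
    IsLocalization.injective L (powers_le_nonZeroDivisors_of_noZeroDivisors hs)
  -- Finite generating set of `B_s`: by well-founded induction, any `u v` with `v ∉ V` is an inverse
  -- from `W` times a polynomial in earlier members.
  let W : Finset L := V.image (fun v => ι (u v)) ∪ T.image (fun S => Ring.inverse (ι S)) ∪
    {IsLocalization.Away.invSelf s}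
  let E : Subalgebra A L := Algebra.adjoin A (W : Set L)
  have hE : ∀ x ∈ W, x ∈ E := fun x hx => Algebra.subset_adjoin hx
  have huE : ∀ v, ι (u v) ∈ E := by
    intro v
    induction v using WellFoundedLT.induction with
    | ind v ih =>
      by_cases hv : v ∈ V
      · exact hE _ (Finset.mem_union_left _ (Finset.mem_union_left _
          (Finset.mem_image_of_mem (fun v => ι (u v)) hv)))
      · obtain ⟨S, hS, hSv⟩ := h v hv
        have hle : Algebra.adjoin A (u '' Set.Iio v) ≤ E.comap ι :=
          Algebra.adjoin_le (by rintro _ ⟨w, hw, rfl⟩; exact ih w hw)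
        have h1 : ι (S * u v) ∈ E := hle hSv
        have hunit : IsUnit (ι S) :=
          IsLocalization.Away.isUnit_of_dvd s (Finset.dvd_prod_of_mem _ hS)
        have h2 : Ring.inverse (ι S) ∈ E := hE _ (Finset.mem_union_left _
          (Finset.mem_union_right _ (Finset.mem_image_of_mem (fun S => Ring.inverse (ι S)) hS)))
        have h3 := mul_mem h2 h1
        rwa [map_mul, Ring.inverse_mul_cancel_left _ _ hunit] at h3
  have hBE : ∀ b, ι b ∈ E := by
    have hle : Algebra.adjoin A (Set.range u) ≤ E.comap ι :=
      Algebra.adjoin_le (by rintro _ ⟨w, rfl⟩; exact huE w)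
    rw [hu] at hle
    exact fun b => hle trivial
  have hfin : Algebra.FiniteType A L := by
    refine ⟨⟨W, top_unique fun x _ => ?_⟩⟩
    obtain ⟨n, a, ha⟩ := IsLocalization.Away.surj s x
    have h1 : ι a * IsLocalization.Away.invSelf s ^ n = x := by
      change algebraMap B L a * _ = x
      rw [← ha, mul_assoc, ← mul_pow, IsLocalization.Away.mul_invSelf, one_pow, mul_one]
    rw [← h1]
    exact mul_mem (hBE a) (pow_mem (hE _ (Finset.mem_union_right _ (Finset.mem_singleton_self _))) n)
  have : IsDomain L := Localization.Away.isDomain hs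
  have hAL : Function.Injective (algebraMap A L) := by
    rw [IsScalarTower.algebraMap_eq A B L]
    exact hι.comp hinj
  exact GenericallyFlat.of_away hs (GenericallyFlat.of_finiteType hAL)

/-- Let `B` be generated by a well-ordered family such that, apart from finitely many exceptions,
each member which is algebraic over its predecessors is a fraction in them with denominator
from a finite set. Then `B` is generically flat over `A`. -/
theorem GenericallyFlat.of_triangular [LinearOrder I] [WellFoundedLT I] [IsDomain B] {u : I → B}
    (hinj : Function.Injective (algebraMap A B)) (hu : Algebra.adjoin A (Set.range u) = ⊤)
    (V : Finset I) (T : Finset B) (hT : ∀ S ∈ T, S ≠ 0)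
    (h : ∀ v ∉ V, IsAlgebraic (Algebra.adjoin A (u '' Set.Iio v)) (u v) →
      ∃ S ∈ T, S * u v ∈ Algebra.adjoin A (u '' Set.Iio v)) : GenericallyFlat A B := by
  classical
  set N : Set I := {v | Transcendental (Algebra.adjoin A (u '' Set.Iio v)) (u v)}
  let P := Algebra.adjoin A (u '' N)
  have hflat : Module.Flat A P :=
    (algebraicIndepOn_of_forall_transcendental_Iio hinj fun v hv => hv).flat_adjoin
  have hle (s : Set B) : Algebra.adjoin A s ≤ (Algebra.adjoin P s).restrictScalars A :=
    Algebra.adjoin_le Algebra.subset_adjoin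
  -- Over the base `P` the transcendental members are scalars, so denominator `1` serves for them.
  refine (GenericallyFlat.of_flat A P).trans Subtype.val_injective
    (GenericallyFlat.of_quasilinear (u := u) Subtype.val_injective ?_ V (insert 1 T) ?_ ?_)
  · refine top_unique fun x _ => hle _ ?_
    rw [hu]
    trivial
  · intro S hS
    rcases Finset.mem_insert.1 hS with rfl | hS
    · exact one_ne_zero
    · exact hT S hS
  · intro v hv
    by_cases hvN : v ∈ N
    · refine ⟨1, Finset.mem_insert_self _ _, ?_⟩
      rw [one_mul]
      exact Subalgebra.algebraMap_mem _ (⟨u v, Algebra.subset_adjoin ⟨v, hvN, rfl⟩⟩ : P)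
    · obtain ⟨S, hS, hSv⟩ := h v hv (not_not.1 hvN)
      exact ⟨S, Finset.mem_insert_of_mem hS, hle _ hSv⟩

end Triangular

/-! ### Separants and the ranking of derivatives -/

namespace DiffRing

variable {Δ A B I : Type*} [CommRing A] [CommRing B] [Algebra A B]

theorem aeval_mem_of_le {C E : Subalgebra A B} (hCE : C ≤ E) {x : B} (hx : x ∈ E) (F : C[X]) :
    aeval x F ∈ E := by
  rw [aeval_eq_sum_range]
  exact sum_mem fun n _ => mul_mem (hCE (F.coeff n).2) (pow_mem hx n)

variable [DiffRing Δ B]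

theorem deriv_aeval_sub_mem {i : Δ} {C E : Subalgebra A B}
    (hC : ∀ c ∈ C, deriv i c ∈ E) {x : B} (hx : x ∈ E) (F : C[X]) :
    deriv i (aeval x F) - aeval x (derivative F) * deriv i x ∈ E := by
  induction F using Polynomial.induction_on' with
  | add p q hp hq =>
    have := add_mem hp hq
    simp only [map_add]
    convert this using 1
    ring
  | monomial n c =>
    have h : deriv i (aeval x (monomial n c)) - aeval x (derivative (monomial n c)) * deriv i x =
        x ^ n * deriv i (c : B) := by
      rw [derivative_monomial, aeval_monomial, aeval_monomial, Derivation.leibniz,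
        Derivation.leibniz_pow]
      change (c : B) • (n • x ^ (n - 1) • deriv i x) + x ^ n • deriv i (c : B) -
        ((c * (n : C) : C) : B) * _ * _ = _
      simp only [smul_eq_mul, nsmul_eq_mul, MulMemClass.coe_mul, SubringClass.coe_natCast]
      ring
    rw [h]
    exact mul_mem (pow_mem hx n) (hC c c.2)

/-- The separant of a minimal relation for `x` over `C` clears the denominator of `δ x`. -/
theorem exists_separant [CharZero B] [IsDomain B] {C : Subalgebra A B} {x : B}
    (hx : IsAlgebraic C x) :
    ∃ S : B, S ≠ 0 ∧ (∀ E : Subalgebra A B, C ≤ E → x ∈ E → S ∈ E) ∧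
      ∀ (i : Δ) (E : Subalgebra A B), C ≤ E → (∀ c ∈ C, deriv i c ∈ E) → x ∈ E →
        S * deriv i x ∈ E := by
  classical
  have hH : ∃ d : ℕ, ∃ F : C[X], F ≠ 0 ∧ aeval x F = 0 ∧ F.natDegree = d := by
    obtain ⟨F, hF, h⟩ := hx
    exact ⟨_, F, hF, h, rfl⟩
  obtain ⟨F, hF, hFx, hFd⟩ := Nat.find_spec hH
  have hd0 : F.natDegree ≠ 0 := by
    intro h0
    rw [eq_C_of_natDegree_eq_zero h0, aeval_C] at hFx
    apply hF
    rw [eq_C_of_natDegree_eq_zero h0, (Subtype.ext hFx : F.coeff 0 = 0), C_0]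
  have hCC : CharZero C := ⟨fun m n h => Nat.cast_injective (R := B) (by
    simpa using congrArg (fun z : C => (z : B)) h)⟩
  have hlt : (derivative F).natDegree < F.natDegree := natDegree_derivative_lt hd0
  have hF' : derivative F ≠ 0 := fun h => hd0 (derivative_eq_zero.1 h)
  -- The separant `F'(x)` is nonzero because `F` has minimal degree and the characteristic is zero.
  refine ⟨aeval x (derivative F), fun h => ?_, fun E hCE hxE => aeval_mem_of_le hCE hxE _, ?_⟩
  · exact Nat.find_min hH (hFd ▸ hlt) ⟨_, hF', h, rfl⟩
  · intro i E hCE hCd hxE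
    have h := deriv_aeval_sub_mem hCd hxE F
    rw [hFx, map_zero, zero_sub] at h
    exact neg_mem_iff.1 h

variable [DiffRing Δ A]

theorem deriv_mem_of_mem_adjoin (hf : IsDiffHom Δ (algebraMap A B)) {i : Δ} {s : Set B}
    {E : Subalgebra A B} (hs : s ⊆ E) (hds : ∀ x ∈ s, deriv i x ∈ E) {x : B}
    (hx : x ∈ Algebra.adjoin A s) : deriv i x ∈ E := by
  have hle : Algebra.adjoin A s ≤ E := Algebra.adjoin_le hs
  induction hx using Algebra.adjoin_induction with
  | mem x hx => exact hds x hx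
  | algebraMap a => rw [← hf]; exact E.algebraMap_mem _
  | add x y _ _ hx hy => rw [map_add]; exact add_mem hx hy
  | mul x y hx' hy' hx hy =>
    rw [Derivation.leibniz]
    exact add_mem (mul_mem (hle hx') hy) (mul_mem (hle hy') hx)

/-- One separant serves all proper derivatives: differentiating `S * u b` yields `S * u (τ i b)`
plus `u b * δS`, and the latter only involves terms below `τ i b`. -/
theorem exists_separant_of_shift [CharZero B] [IsDomain B] [LinearOrder I]
    (hf : IsDiffHom Δ (algebraMap A B)) {u : I → B} {τ : Δ → I → I} (hτ : ∀ i, StrictMono (τ i))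
    (hτ' : ∀ i v, v < τ i v) (hu : ∀ i v, deriv i (u v) = u (τ i v)) {w : I}
    (hw : IsAlgebraic (Algebra.adjoin A (u '' Set.Iio w)) (u w)) :
    ∃ S : B, S ≠ 0 ∧ ∀ v, Relation.TransGen (fun a b => ∃ i, b = τ i a) w v →
      S * u v ∈ Algebra.adjoin A (u '' Set.Iio v) := by
  obtain ⟨S, hS0, hS, hSd⟩ := exists_separant (Δ := Δ) hw
  have hmem {a b : I} (h : a < b) : u a ∈ Algebra.adjoin A (u '' Set.Iio b) :=
    Algebra.subset_adjoin ⟨a, h, rfl⟩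
  have hmono {a b : I} (h : a < b) :
      Algebra.adjoin A (u '' Set.Iio a) ≤ Algebra.adjoin A (u '' Set.Iio b) :=
    Algebra.adjoin_mono (Set.image_mono (Set.Iio_subset_Iio h.le))
  have hder (i : Δ) (a x) (hx : x ∈ Algebra.adjoin A (u '' Set.Iio a)) :
      deriv i x ∈ Algebra.adjoin A (u '' Set.Iio (τ i a)) := by
    refine deriv_mem_of_mem_adjoin hf ?_ ?_ hx
    · rintro _ ⟨b, hb, rfl⟩
      exact hmem (lt_trans hb (hτ' i a))
    · rintro _ ⟨b, hb, rfl⟩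
      rw [hu]
      exact hmem (hτ i hb)
  -- The induction also carries `w < v`, which places `S` among polynomials in terms below `v`.
  refine ⟨S, hS0, fun v hv => (?_ : w < v ∧ _).2⟩
  induction hv with
  | single h =>
    obtain ⟨i, rfl⟩ := h
    refine ⟨hτ' i w, ?_⟩
    rw [← hu]
    exact hSd i _ (hmono (hτ' i w)) (hder i w) (hmem (hτ' i w))
  | tail _ h ih =>
    rename_i b c _
    obtain ⟨i, rfl⟩ := h
    refine ⟨ih.1.trans (hτ' i b), ?_⟩
    have h1 := hder i b _ ih.2
    have h2 := hder i b S (hS _ (hmono ih.1) (hmem ih.1))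
    rw [Derivation.leibniz, smul_eq_mul, smul_eq_mul, hu] at h1
    exact (add_mem_cancel_right (mul_mem (hmem (hτ' i b)) h2)).1 h1

/-- The hypothesis `hfin` is the abstract form of Dickson's lemma; it is applied to the indices
algebraic over their predecessors. -/
theorem genericallyFlat_of_shift [CharZero B] [IsDomain B] [LinearOrder I] [WellFoundedLT I]
    (hinj : Function.Injective (algebraMap A B)) (hf : IsDiffHom Δ (algebraMap A B))
    {u : I → B} (hgen : Algebra.adjoin A (Set.range u) = ⊤) {τ : Δ → I → I}
    (hτ : ∀ i, StrictMono (τ i)) (hτ' : ∀ i v, v < τ i v) (hu : ∀ i v, deriv i (u v) = u (τ i v))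
    (hfin : ∀ X : Set I, ∃ V : Finset I, (V : Set I) ⊆ X ∧ ∀ v ∈ X, v ∉ V →
      ∃ w ∈ V, Relation.TransGen (fun a b => ∃ i, b = τ i a) w v) : GenericallyFlat A B := by
  classical
  obtain ⟨V, hVX, hV⟩ := hfin {v | IsAlgebraic (Algebra.adjoin A (u '' Set.Iio v)) (u v)}
  choose S hS0 hS using fun w : V => exists_separant_of_shift hf hτ hτ' hu (hVX w.2)
  refine GenericallyFlat.of_triangular hinj hgen V (Finset.univ.image S) ?_ fun v hv hva => ?_
  · intro x hx
    obtain ⟨w, _, rfl⟩ := Finset.mem_image.1 hx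
    exact hS0 w
  · obtain ⟨w, hw, hwv⟩ := hV v hva hv
    exact ⟨S ⟨w, hw⟩, Finset.mem_image_of_mem _ (Finset.mem_univ _), hS ⟨w, hw⟩ v hwv⟩

/-- The iterated derivative attached to a multiset of derivations. -/
def iterDeriv (Δ : Type*) {B : Type*} [CommRing B] [DiffRing Δ B] (θ : Multiset Δ) (b : B) : B :=
  haveI : LeftCommutative fun (i : Δ) (x : B) => deriv i x := ⟨fun i j x => deriv_comm i j x⟩
  θ.foldr (fun i x => deriv i x) b

theorem iterDeriv_zero (b : B) : iterDeriv Δ 0 b = b := rfl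

theorem iterDeriv_cons (i : Δ) (θ : Multiset Δ) (b : B) :
    iterDeriv Δ (i ::ₘ θ) b = deriv i (iterDeriv Δ θ b) :=
  haveI : LeftCommutative fun (i : Δ) (x : B) => deriv i x := ⟨fun i j x => deriv_comm i j x⟩
  Multiset.foldr_cons _ _ _ _

theorem exists_finset_minimal {α : Type*} [PartialOrder α] [WellQuasiOrderedLE α] (X : Set α) :
    ∃ V : Finset α, (V : Set α) ⊆ X ∧ ∀ v ∈ X, ∃ w ∈ V, w ≤ v := by
  have hfin : {x | Minimal (· ∈ X) x}.Finite :=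
    WellQuasiOrderedLE.finite_of_isAntichain (setOfPred_minimal_antichain _)
  refine ⟨hfin.toFinset, fun x hx => (hfin.mem_toFinset.1 hx).1, fun v hv => ?_⟩
  obtain ⟨w, hwv, hw⟩ := exists_minimal_le_of_wellFoundedLT (· ∈ X) v hv
  exact ⟨w, hfin.mem_toFinset.2 hw, hwv⟩

/-- Shift of the exponent in a ranking of derivatives. -/
noncomputable def shift (m : MonomialOrder Δ) {n : ℕ} (i : Δ) (v : m.syn ×ₗ Fin n) :
    m.syn ×ₗ Fin n :=
  toLex (m.toSyn (Finsupp.single i 1) + (ofLex v).1, (ofLex v).2)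

theorem shift_strictMono (m : MonomialOrder Δ) {n : ℕ} (i : Δ) :
    StrictMono (shift m (n := n) i) := by
  intro v w h
  rw [Prod.Lex.lt_iff] at h ⊢
  rcases h with h | ⟨h1, h2⟩
  · exact Or.inl (add_lt_add_right h _)
  · exact Or.inr ⟨congrArg (m.toSyn (Finsupp.single i 1) + ·) h1, h2⟩

theorem lt_shift (m : MonomialOrder Δ) {n : ℕ} (i : Δ) (v : m.syn ×ₗ Fin n) : v < shift m i v := by
  rw [Prod.Lex.lt_iff]
  refine Or.inl (lt_add_of_pos_left _ ?_)
  rw [m.toSyn_lt_iff_ne_zero]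
  simp [m.toSyn_eq_zero_iff]

theorem transGen_shift (m : MonomialOrder Δ) {n : ℕ} (θ η : Δ →₀ ℕ) (j : Fin n) (hη : η ≠ 0) :
    Relation.TransGen (fun a b => ∃ i, b = shift m i a)
      (toLex (m.toSyn θ, j)) (toLex (m.toSyn (η + θ), j)) := by
  have key : ∀ η θ : Δ →₀ ℕ, Relation.ReflTransGen (fun a b => ∃ i, b = shift m i a)
      (toLex (m.toSyn θ, j)) (toLex (m.toSyn (η + θ), j)) := by
    intro η
    induction η using Finsupp.induction_linear with
    | zero => exact fun θ => by rw [zero_add]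
    | add f g hf hg => exact fun θ => by rw [add_assoc]; exact (hg θ).trans (hf (g + θ))
    | single i k =>
      intro θ
      induction k with
      | zero => rw [Finsupp.single_zero, zero_add]
      | succ k ih =>
        refine ih.tail ⟨i, ?_⟩
        rw [add_comm k 1, Finsupp.single_add, add_assoc, map_add]
        rfl
  refine (Relation.reflTransGen_iff_eq_or_transGen.1 (key η θ)).resolve_left fun h => hη ?_
  have h1 := m.toSyn.injective (congrArg (fun v => (ofLex v).1) h)
  simpa using h1

theorem genericallyFlat [Finite Δ] [CharZero B] [IsDomain B]
    (hinj : Function.Injective (algebraMap A B)) (hf : IsDiffHom Δ (algebraMap A B))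
    (hfg : DiffFiniteType Δ A B) : GenericallyFlat A B := by
  classical
  obtain ⟨t, ht⟩ := hfg
  let _ : LinearOrder Δ := LinearOrder.lift' (Finite.equivFin Δ) (Equiv.injective _)
  let m : MonomialOrder Δ := MonomialOrder.lex
  let b : Fin t.card → B := fun j => (t.equivFin.symm j : B)
  let u : m.syn ×ₗ Fin t.card → B := fun v =>
    iterDeriv Δ (Finsupp.toMultiset (m.toSyn.symm (ofLex v).1)) (b (ofLex v).2)
  have hu : ∀ i v, deriv i (u v) = u (shift m i v) := by
    intro i v
    simp only [u, shift, ofLex_toLex, map_add, AddEquiv.symm_apply_apply,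
      Finsupp.toMultiset_single, one_smul, Multiset.singleton_add, iterDeriv_cons]
  refine genericallyFlat_of_shift hinj hf (u := u) (ht _ ?_ ?_) (shift_strictMono m) (lt_shift m)
    hu ?_
  · intro i x hx
    refine deriv_mem_of_mem_adjoin hf Algebra.subset_adjoin ?_ hx
    rintro _ ⟨v, rfl⟩
    rw [hu]
    exact Algebra.subset_adjoin ⟨_, rfl⟩
  · intro x hx
    refine Algebra.subset_adjoin ⟨toLex (0, t.equivFin ⟨x, hx⟩), ?_⟩
    simp [u, b, iterDeriv_zero]
  · intro X
    -- Dickson's lemma, applied to the exponents occurring with each generator separately.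
    choose V hVX hV using fun j => exists_finset_minimal
      {θ : Δ →₀ ℕ | (toLex (m.toSyn θ, j) : m.syn ×ₗ Fin t.card) ∈ X}
    refine ⟨Finset.univ.biUnion fun j => (V j).image fun θ => toLex (m.toSyn θ, j), ?_, ?_⟩
    · intro v hv
      simp only [Finset.coe_biUnion, Set.mem_iUnion, Finset.coe_image] at hv
      obtain ⟨j, _, θ, hθ, rfl⟩ := hv
      exact hVX j hθ
    · intro v hv hvV
      obtain ⟨θ, j, rfl⟩ : ∃ θ j, v = toLex (m.toSyn θ, j) :=
        ⟨m.toSyn.symm (ofLex v).1, (ofLex v).2, by simp⟩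
      obtain ⟨w, hw, hwθ⟩ := hV j θ hv
      have hmem : ∀ θ ∈ V j, (toLex (m.toSyn θ, j) : m.syn ×ₗ Fin t.card) ∈
          Finset.univ.biUnion fun j => (V j).image fun θ => toLex (m.toSyn θ, j) := fun θ hθ =>
        Finset.mem_biUnion.2 ⟨j, Finset.mem_univ _, Finset.mem_image_of_mem _ hθ⟩
      refine ⟨_, hmem w hw, ?_⟩
      -- The exponent `θ - w` is nonzero because `v` is not among the chosen minimal elements, so
      -- `v` is a proper derivative.
      have h1 := transGen_shift m w (θ - w) j (fun h0 => hvV ?_)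
      · rwa [tsub_add_cancel_of_le hwθ] at h1
      · have : θ = w := le_antisymm (tsub_eq_zero_iff_le.1 h0) hwθ
        exact this ▸ hmem w hw

end DiffRing

theorem mainTheorem1 {Δ : Type*} [Finite Δ]
    {A B : Type*} [CommRing A] [CommRing B] [Algebra ℚ A] [Algebra ℚ B]
    [DiffRing Δ A] [DiffRing Δ B] [IsDomain B] [Algebra A B]
    (hinj : Function.Injective (algebraMap A B))
    (hdiff : DiffRing.IsDiffHom Δ (algebraMap A B))
    (hfg : DiffRing.DiffFiniteType Δ A B) :
    ∃ s : B, s ≠ 0 ∧ Function.Injective (algebraMap A (Localization.Away s)) ∧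
      DiffRing.HasDiffGoingDown (Δ := Δ) (algebraMap A (Localization.Away s))
        (DiffRing.isDiffHom_away s hdiff) := by
  have : CharZero B := algebraRat.charZero B
  obtain ⟨s, hs, hflat⟩ := DiffRing.genericallyFlat hinj hdiff hfg
  refine ⟨s, hs, ?_, DiffRing.hasDiffGoingDown_of_flat _⟩
  rw [IsScalarTower.algebraMap_eq A B (Localization.Away s)]
  exact (IsLocalization.injective (Localization.Away s)
    (powers_le_nonZeroDivisors_of_noZeroDivisors hs)).comp hinj
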